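/- Let $A$ be a finite alphabet. For $u,w\in A^*$ let $|w|_u=\#\{(x,y)\in A^*\times A^* : xuy=w\}$ be the number of occurrences of $u$ in $w$ as a contiguous factor, and for $w_1,\dots,w_k\in A^*$ let $$\mathrm{WMIX}(w_1,\dots,w_k)=\{w\in A^* : |w|_{w_1}=\cdots=|w|_{w_k}\}.$$ **Decidability.** There is an algorithm which, given two finite lists of words $w_1,\dots,w_k$ and $w'_1,\dots,w'_{k'}$ over $A$, decides whether $\mathrm{WMIX}(w_1,\dots,w_k)=\mathrm{WMIX}(w'_1,\dots,w'_{k'})$. **Decision criterion.** Let $N$ be the maximum of the lengths of all the words $w_i,w'_j$, and let $G_N$ be the $N$-dimensional de Bruijn graph over $A$, whose vertices are the words of length $N$ and whose edges are the pairs $(ax,xb)$ with $a,b\in A$, $x\in A^{N-1}$ (there are no edges if $N=0$). A walk is a nonempty sequence of successively adjacent vertices, a path is a walk without repeated vertices, and a cycle is a walk $(v,v_1,\dots,v_n,v)$, $n\ge 0$, with $v,v_1,\dots,v_n$ distinct. A walk is decomposed from left to right into a path and a sequence of cycles: start with the path consisting of the first vertex and with no cycles; for each next vertex $v$, append $v$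 to the current path if $v$ is not on it; otherwise, if the current path is $(v_1,\dots,v_{j-1},v,v_{j+1},\dots,v_n)$, replace it by $(v_1,\dots,v_{j-1},v)$ and append the cycle $(v,v_{j+1},\dots,v_n,v)$ to the sequence of cycles. The trace of the walk is the set consisting of the final path and of all the cycles in its sequence. For a word $u$ and a walk $\omega=(v_0,\dots,v_n)$ let $|\omega|_u=\#\{i\in\{1,\dots,n\} : u \text{ is a suffix of } v_i\}$. For a trace $T=\{\pi\}\cup\{\gamma_1,\dots,\gamma_m\}$, with path $\pi$ starting at the vertex $v$ and distinct cycles $\gamma_1,\dots,\gamma_m$, let $$\theta_T^u = |v|_u+|\pi|_u+\sum_{i=1}^m \underbrace{x_i+\cdots+x_i}_{|\gamma_i|_u\text{ times}}$$ and let $\psi_T$ be the sentence of Presburger arithmetic (in the language $0,1,+$) $$\forall x_1\cdots\forall x_m\;\Bigl(x_1>0\wedge\cdots\wedge x_m>0\;\Rightarrow\;\bigl(\theta_T^{w_1}=\cdots=\theta_T^{w_k}\;\Leftrightarrow\;\theta_T^{w'_1}=\cdots=\theta_T^{w'_{k'}}\bigr)\Bigr),$$ where $x>0$ abbreviates $\neg\,x=0$.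 Then $G_N$ has only finitely many traces, every $\psi_T$ is a universal ($\Pi_1$) sentence, and $\mathrm{WMIX}(w_1,\dots,w_k)=\mathrm{WMIX}(w'_1,\dots,w'_{k'})$ if and only if 1. the two languages contain the same words of length less than $N$, and 2. for every trace $T$ of a walk in $G_N$ and every such enumeration of $T$, the sentence $\psi_T$ is true in $\mathbb{N}$. -/

import Mathlib

namespace WordMix

section Words

variable {A : Type*}

/-- `occ u w` is `|w|_u`, the number of occurrences of `u` in `w` as a contiguous factor. -/
noncomputable def occ (u w : List A) : ℕ :=
  Set.ncard {p : List A × List A | p.1 ++ u ++ p.2 = w}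

/-- `WMIX(w₁, …, w_k) = {w | |w|_{w₁} = ⋯ = |w|_{w_k}}`. -/
def WMIX (ws : List (List A)) : Language A :=
  {w : List A | ∀ u ∈ ws, ∀ v ∈ ws, occ u w = occ v w}

/-- The maximal length of a word in a list of words. -/
def maxLength (ws : List (List A)) : ℕ :=
  (ws.map List.length).foldr max 0

end Words

section Graphs

variable {V : Type*}

/-- A walk is a nonempty sequence of successively adjacent vertices. -/
def IsWalk (G : Digraph V) (ω : List V) : Prop :=
  ω ≠ [] ∧ ω.IsChain G.Adj

/-- A path is a walk without repeated vertices. -/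
def IsPath (G : Digraph V) (π : List V) : Prop :=
  IsWalk G π ∧ π.Nodup

/-- A cycle is a walk `(v, v₁, …, v_n, v)`, `n ≥ 0`, such that `v, v₁, …, v_n` are distinct. -/
def IsCycle (G : Digraph V) (γ : List V) : Prop :=
  IsWalk G γ ∧ ∃ (v : V) (p : List V), γ = v :: p ++ [v] ∧ (v :: p).Nodup

variable [DecidableEq V]

/-- One step of the left-to-right path-cycle decomposition: the current path is extended by the
vertex `v` if `v` is new; otherwise the cycle closed by `v` is cut off. -/
def decStep (s : List V × List (List V)) (v : V) : List V × List (List V) :=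
  if v ∈ s.1 then
    (s.1.takeWhile (fun x => x ≠ v) ++ [v], s.2 ++ [s.1.dropWhile (fun x => x ≠ v) ++ [v] ])
  else (s.1 ++ [v], s.2)

/-- The path-cycle decomposition of a walk: its final path and its sequence of cycles. -/
def dec : List V → List V × List (List V)
  | [] => ([], [])
  | v :: ω => ω.foldl decStep ([v], [])

/-- The multi-trace of a walk: its final path has multiplicity one, and a cycle has the number of
its occurrences in the decomposition as its multiplicity. -/
def multiTrace (ω : List V) (x : List V) : ℕ :=
  (if x = (dec ω).1 then 1 else 0) + (dec ω).2.count x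

/-- The trace of a walk: the paths and cycles with nonzero multiplicity. -/
def trace (ω : List V) : Set (List V) :=
  {x | multiTrace ω x ≠ 0}

/-- The set of all traces of walks of a graph. -/
def traces (G : Digraph V) : Set (Set (List V)) :=
  {T | ∃ ω, IsWalk G ω ∧ T = trace ω}

/-- `T = {π} ∪ {γ₁, …, γ_m}` with a path `π` and distinct cycles `γ₁, …, γ_m`. -/
def Enumerates (G : Digraph V) (T : Set (List V)) (π : List V) (γs : List (List V)) : Prop :=
  IsPath G π ∧ (∀ γ ∈ γs, IsCycle G γ) ∧ γs.Nodup ∧ T = {π} ∪ {γ | γ ∈ γs}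

end Graphs

section DeBruijn

variable {A : Type*}

/-- The `N`-dimensional de Bruijn graph over `A`: its vertices are the words of length `N`, and its
edges are the pairs `(a x, x b)` with letters `a`, `b` and a word `x` of length `N - 1`. -/
def deBruijn (A : Type*) (N : ℕ) : Digraph (List.Vector A N) where
  Adj u v := ∃ (a b : A) (x : List A), u.toList = a :: x ∧ v.toList = x ++ [b]

variable [DecidableEq A] {N : ℕ}

/-- The number of vertices of a walk, its first one excluded, that have `u` as a suffix. -/
def walkOcc (u : List A) (ω : List (List.Vector A N)) : ℕ :=
  (ω.tail.map (fun v => if u <:+ v.toList then 1 else 0)).sum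

/-- `|v|_u + |π|_u` for a path `π` with source `v`. -/
noncomputable def pathOcc (u : List A) : List (List.Vector A N) → ℕ
  | [] => 0
  | v :: π => occ u v.toList + walkOcc u (v :: π)

end DeBruijn

section Presburger

open FirstOrder FirstOrder.Language

variable {A : Type*} [DecidableEq A] {N : ℕ}

/-- The variable `x_i`. -/
def presVar {m : ℕ} (i : Fin m) : Language.presburger.Term (Empty ⊕ Fin m) :=
  Term.var (Sum.inr i)

/-- The Presburger term `θ^u = |v|_u + |π|_u + ∑ᵢ (xᵢ + ⋯ + xᵢ)`, where `v` is the source of the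
path `π` and `xᵢ` is repeated `|γᵢ|_u` times. -/
noncomputable def theta (π : List (List.Vector A N)) (γs : List (List (List.Vector A N)))
    (u : List A) : Language.presburger.Term (Empty ⊕ Fin γs.length) :=
  (pathOcc u π : Language.presburger.Term (Empty ⊕ Fin γs.length)) +
    ((List.finRange γs.length).map (fun i => walkOcc u (γs.get i) • presVar i)).sum

/-- The formula `θ^{w₁} = ⋯ = θ^{w_k}`. -/
noncomputable def balance (π : List (List.Vector A N)) (γs : List (List (List.Vector A N)))
    (ws : List (List A)) : Language.presburger.BoundedFormula Empty γs.length :=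
  (ws.flatMap (fun u => ws.map (fun v =>
    (theta π γs u).bdEqual (theta π γs v)))).foldr (· ⊓ ·) ⊤

/-- The formula `x₁ > 0 ∧ ⋯ ∧ x_m > 0`, where `x > 0` is written `¬ x = 0`. -/
def positive (m : ℕ) : Language.presburger.BoundedFormula Empty m :=
  ((List.finRange m).map (fun i => ∼ ((presVar i).bdEqual 0))).foldr (· ⊓ ·) ⊤

/-- The sentence
`∀ x₁ … x_m, x₁ > 0 ∧ ⋯ ∧ x_m > 0 → (θ^{w₁} = ⋯ = θ^{w_k} ↔ θ^{w'₁} = ⋯ = θ^{w'_{k'}})`. -/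
noncomputable def psi (ws ws' : List (List A)) (π : List (List.Vector A N))
    (γs : List (List (List.Vector A N))) : Language.presburger.Sentence :=
  BoundedFormula.alls
    ((positive γs.length).imp ((balance π γs ws).iff (balance π γs ws')))

end Presburger

end WordMix

/-! Slide a window of length `N ≥ 1` along a word of length at least `N`: the windows form a walk in
the de Bruijn graph. An occurrence of `u`, `|u| ≤ N`, either lies in the first window or ends at the
last letter of exactly one later window. So `occ u w` is a constant of the first window plus an
additive vertex weight of the walk, and path-cycle decomposition preserves such weights
(`isDecomposition_dec`). Membership in `WMIX` therefore depends only on the path and the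
multiplicities of the cycles, through linear equations.

Conversely, every choice of positive multiplicities for a trace comes from a walk with the same
source (`Attached.exists_walk`): each cycle starts on the final path or on a later cycle, so the
cycles can be spliced back in from the last to the first. These two facts give the criterion by
Presburger sentences.

Decidability is obtained from a bound on witnesses. A word in one language but not in the other
gives multiplicities that satisfy linear equations and one strict inequality. A pigeonhole on
partial sums yields a solution of bounded size on the same cycles (`exists_small_solution`), hence a
separating word of bounded length (`exists_short_witness`). The bound is primitive recursive, so
testing all shorter words decides equality. -/

namespace WordMix

/-! ### Occurrences of factors in words -/

section Words

variable {A : Type*}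

theorem occ_set_finite (u w : List A) :
    {p : List A × List A | p.1 ++ u ++ p.2 = w}.Finite := by
  refine Set.Finite.subset ((List.finite_toSet w.inits).prod (List.finite_toSet w.tails)) ?_
  rintro ⟨x, y⟩ h
  simp only [Set.mem_ofPred_eq] at h
  subst h
  simp only [Set.mem_prod, Set.mem_ofPred_eq, List.mem_inits, List.mem_tails]
  exact ⟨⟨u ++ y, by simp⟩, ⟨x ++ u, by simp⟩⟩

/-- An occurrence either avoids the new last letter or ends there, and at most one ends there. -/
theorem occ_append_singleton [DecidableEq A] (u w : List A) (b : A) :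
    occ u (w ++ [b]) = occ u w + if u <:+ w ++ [b] then 1 else 0 := by
  have h1 : {p : List A × List A | p.1 ++ u ++ p.2 = w ++ [b]} =
      (fun p : List A × List A => (p.1, p.2 ++ [b])) '' {p | p.1 ++ u ++ p.2 = w} ∪
        {p | p.1 ++ u = w ++ [b] ∧ p.2 = []} := by
    ext ⟨x, y⟩
    simp only [Set.mem_ofPred_eq, Set.mem_union, Set.mem_image, Prod.mk.injEq, Prod.exists]
    constructor
    · intro h
      rcases List.eq_nil_or_concat y with rfl | ⟨z, c, rfl⟩
      · right; simpa using h
      · left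
        rw [List.concat_eq_append] at h ⊢
        rw [← List.append_assoc] at h
        obtain ⟨h, h'⟩ := List.append_inj' h rfl
        simp only [List.cons.injEq, and_true] at h'
        exact ⟨x, z, h, rfl, by rw [h']⟩
    · rintro (⟨a, c, h, rfl, rfl⟩ | ⟨h, rfl⟩)
      · rw [← h]; simp
      · simpa using h
  have hinj : Function.Injective (fun p : List A × List A => (p.1, p.2 ++ [b])) := by
    rintro ⟨a, c⟩ ⟨a', c'⟩ h
    simpa using h
  have hdisj : Disjoint ((fun p : List A × List A => (p.1, p.2 ++ [b])) ''
      {p | p.1 ++ u ++ p.2 = w}) {p | p.1 ++ u = w ++ [b] ∧ p.2 = []} := by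
    rw [Set.disjoint_left]
    rintro ⟨x, y⟩ ⟨⟨a, c⟩, -, h⟩ ⟨-, h'⟩
    simp only [Prod.mk.injEq] at h h'
    simp [← h.2] at h'
  have hfin : {p : List A × List A | p.1 ++ u = w ++ [b] ∧ p.2 = []}.Finite :=
    (occ_set_finite u (w ++ [b])).subset (by rintro ⟨x, y⟩ ⟨h, h'⟩; simp_all)
  rw [occ, h1, Set.ncard_union_eq hdisj ((occ_set_finite u w).image _) hfin,
    Set.ncard_image_of_injective _ hinj, occ]
  congr 1
  split_ifs with h
  · obtain ⟨x, hx⟩ := h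
    rw [Set.ncard_eq_one]
    refine ⟨(x, []), ?_⟩
    ext ⟨x', y⟩
    simp only [Set.mem_ofPred_eq, Set.mem_singleton_iff, Prod.mk.injEq, and_congr_left_iff]
    rintro -
    rw [← hx]
    exact List.append_left_inj u
  · rw [Set.ncard_eq_zero hfin, Set.eq_empty_iff_forall_notMem]
    rintro ⟨x, y⟩ ⟨h', -⟩
    exact h ⟨x, h'⟩

theorem occ_nil_right_le (u : List A) : occ u ([] : List A) ≤ 1 := by
  rw [occ, Set.ncard_le_one (occ_set_finite u [])]
  rintro ⟨x, y⟩ h ⟨x', y'⟩ h'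
  simp_all

theorem occ_le (u w : List A) : occ u w ≤ w.length + 1 := by
  classical
  induction w using List.reverseRecOn with
  | nil => exact occ_nil_right_le u
  | append_singleton w b ih =>
    rw [occ_append_singleton, List.length_append, List.length_singleton]
    split_ifs <;> omega

theorem length_le_maxLength {ws : List (List A)} {u : List A} (hu : u ∈ ws) :
    u.length ≤ maxLength ws := by
  induction ws with
  | nil => simp at hu
  | cons v ws ih =>
    simp only [maxLength, List.map_cons, List.foldr_cons] at ih ⊢
    rcases List.mem_cons.1 hu with rfl | hu
    · exact le_max_left _ _
    · exact (ih hu).trans (le_max_right _ _)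

theorem suffix_iff_of_length_le {u v w : List A} (hv : v <:+ w) (h : u.length ≤ v.length) :
    u <:+ w ↔ u <:+ v :=
  ⟨fun hu => List.suffix_of_suffix_length_le hu hv h, fun hu => hu.trans hv⟩

end Words

/-! ### Additive weights of walks -/

section Weight

variable {V : Type*}

/-- The weight of a walk: the sum of the weights of its vertices, the first one excluded. -/
def weight (f : V → ℕ) (ω : List V) : ℕ := (ω.tail.map f).sum

theorem weight_append {ω ω' : List V} (f : V → ℕ) (h : ω ≠ []) :
    weight f (ω ++ ω') = weight f ω + (ω'.map f).sum := by
  simp [weight, List.tail_append_of_ne_nil h]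

/-- With constant weight, the additivity identities for weights also control the lengths of walks
and words. -/
theorem weight_one (ω : List V) : weight (fun _ => 1) ω = ω.length - 1 := by
  simp [weight]

theorem weight_le {f : V → ℕ} (hf : ∀ v, f v ≤ 1) (ω : List V) :
    weight f ω ≤ ω.length - 1 := by
  have := List.sum_le_card_nsmul (ω.tail.map f) 1 (by
    intro x hx
    obtain ⟨v, -, rfl⟩ := List.mem_map.1 hx
    exact hf v)
  simpa [weight] using this

end Weight

/-! ### Words as walks in the de Bruijn graph -/

section DeBruijn

variable {A : Type*} [DecidableEq A] {N : ℕ}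

theorem walkOcc_eq_weight (u : List A) (ω : List (List.Vector A N)) :
    walkOcc u ω = weight (fun v => if u <:+ v.toList then 1 else 0) ω := rfl

theorem walkOcc_le (u : List A) (ω : List (List.Vector A N)) : walkOcc u ω ≤ ω.length - 1 :=
  weight_le (fun v => by split_ifs <;> simp) ω

theorem pathOcc_eq {u : List A} {ω : List (List.Vector A N)} {v : List.Vector A N}
    (h : ω.head? = some v) : pathOcc u ω = occ u v.toList + walkOcc u ω := by
  cases ω with
  | nil => simp at h
  | cons a ω => simp only [List.head?_cons, Option.some.injEq] at h; subst h; rfl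

theorem pathOcc_append_singleton (u : List A) {ω : List (List.Vector A N)} (h : ω ≠ [])
    (v : List.Vector A N) :
    pathOcc u (ω ++ [v]) = pathOcc u ω + if u <:+ v.toList then 1 else 0 := by
  cases ω with
  | nil => simp at h
  | cons a ω => simp [pathOcc, walkOcc, add_assoc]

/-- The walk `ω` reads the word `w`. -/
structure Reads (ω : List (List.Vector A N)) (w : List A) : Prop where
  isWalk : IsWalk (deBruijn A N) ω
  last : ∃ v, ω.getLast? = some v ∧ v.toList <:+ w
  length : w.length + 1 = N + ω.length
  occ : ∀ u : List A, u.length ≤ N → occ u w = pathOcc u ω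

theorem reads_singleton (v : List.Vector A N) : Reads [v] v.toList where
  isWalk := ⟨by simp, by simp⟩
  last := ⟨v, by simp⟩
  length := by simp
  occ u _ := by simp [pathOcc, walkOcc]

/-- The new window is the suffix of length `N` of the longer word, so it decides whether `u` with
`|u| ≤ N` ends there. -/
theorem Reads.append {ω : List (List.Vector A N)} {w : List A} (h : Reads ω w)
    {l v : List.Vector A N} (hl : ω.getLast? = some l) {a b : A} {x : List A}
    (hla : l.toList = a :: x) (hv : v.toList = x ++ [b]) : Reads (ω ++ [v]) (w ++ [b]) := by
  obtain ⟨l', hl', hs⟩ := h.last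
  obtain rfl : l = l' := by rw [hl] at hl'; exact Option.some.inj hl'
  have hvs : v.toList <:+ w ++ [b] := by
    rw [hv, List.suffix_append_inj_of_length_eq rfl]
    refine ⟨?_, rfl⟩
    exact ((List.suffix_cons a x).trans (hla ▸ hs))
  refine ⟨⟨by simp, ?_⟩, ⟨v, by simp, hvs⟩, ?_, ?_⟩
  · rw [List.isChain_append]
    refine ⟨h.isWalk.2, by simp, ?_⟩
    intro y hy z hz
    rw [hl] at hy
    simp only [Option.mem_def, Option.some.injEq, List.head?_cons] at hy hz
    subst hy hz
    exact ⟨a, b, x, hla, hv⟩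
  · simp only [List.length_append, List.length_singleton]
    have := h.length
    omega
  · intro u hu
    rw [occ_append_singleton, pathOcc_append_singleton u h.isWalk.1, h.occ u hu]
    congr 1
    simp only [suffix_iff_of_length_le hvs (by simpa using hu : u.length ≤ v.toList.length)]

theorem IsWalk.exists_reads {ω : List (List.Vector A N)} (h : IsWalk (deBruijn A N) ω) :
    ∃ w, Reads ω w := by
  obtain ⟨h0, h⟩ := h
  induction ω using List.reverseRecOn with
  | nil => exact absurd rfl h0
  | append_singleton ω v ih =>
    rcases List.eq_nil_or_concat ω with rfl | ⟨ω', l, rfl⟩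
    · exact ⟨_, reads_singleton v⟩
    · rw [List.isChain_append] at h
      obtain ⟨w, hw⟩ := ih (by simp) h.1
      obtain ⟨a, b, x, h1, h2⟩ := h.2.2 l (by simp) v (by simp)
      exact ⟨_, hw.append (by simp) h1 h2⟩

/-- For `N = 0` there are no edges, and the only walks have one vertex and read the empty word; this
case has to be excluded. -/
theorem exists_walk_reads (hN : N ≠ 0) {w : List A} (h : N ≤ w.length) :
    ∃ ω : List (List.Vector A N), Reads ω w := by
  induction w using List.reverseRecOn with
  | nil => simp at h; exact absurd h hN
  | append_singleton w b ih =>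
    rcases h.eq_or_lt with h | h
    · exact ⟨[⟨w ++ [b], h.symm⟩], reads_singleton _⟩
    · simp only [List.length_append, List.length_singleton, Nat.lt_succ_iff] at h
      obtain ⟨ω, hω⟩ := ih h
      obtain ⟨l, hl, -⟩ := hω.last
      rcases hl' : l.toList with _ | ⟨a, x⟩
      · have : l.toList.length = N := l.toList_length
        simp [hl'] at this; omega
      · have hx : (x ++ [b]).length = N := by
          have : l.toList.length = N := l.toList_length
          simpa [hl'] using this
        exact ⟨_, hω.append (v := ⟨x ++ [b], hx⟩) hl hl' rfl⟩

end DeBruijn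

/-! ### Path-cycle decomposition and its reversal -/

section Decomposition

variable {V : Type*}

/-- Every cycle of the list starts at a vertex of `p` or of a later cycle. -/
inductive Attached (p : List V) : List (List V) → Prop
  | nil : Attached p []
  | cons {γ : List V} {cs : List (List V)} (v : V) (hγ : γ.head? = some v)
      (hv : v ∈ p ∨ ∃ δ ∈ cs, v ∈ δ) (h : Attached p cs) : Attached p (γ :: cs)

/-- Closing a cycle `γ` shortens the path from `p` to `q`, but the vertices cut off lie on `γ`.
Since `γ` comes last, cycles that hung on those vertices now hang on a later cycle. -/
theorem Attached.append_singleton {p q γ : List V} {cs : List (List V)} (h : Attached p cs)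
    (hp : ∀ v ∈ p, v ∈ q ∨ v ∈ γ) {v : V} (hγ : γ.head? = some v) (hv : v ∈ q) :
    Attached q (cs ++ [γ]) := by
  induction h with
  | nil => exact .cons v hγ (.inl hv) .nil
  | cons a ha hv' _ ih =>
    refine .cons a ha ?_ ih
    rcases hv' with hv' | ⟨δ, hδ, hv'⟩
    · rcases hp a hv' with h | h
      · exact .inl h
      · exact .inr ⟨γ, by simp, h⟩
    · exact .inr ⟨δ, by simp [hδ], hv'⟩

theorem Attached.mono {p q : List V} {cs : List (List V)} (h : Attached p cs)
    (hp : ∀ v ∈ p, v ∈ q) : Attached q cs := by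
  induction h with
  | nil => exact .nil
  | cons a ha hv' _ ih => exact .cons a ha (hv'.imp (hp a) id) ih

/-- The relation between a walk and its path-cycle decomposition. -/
structure IsDecomposition (G : Digraph V) (ω p : List V) (cs : List (List V)) : Prop where
  isPath : IsPath G p
  head : p.head? = ω.head?
  last : p.getLast? = ω.getLast?
  isCycle : ∀ γ ∈ cs, IsCycle G γ
  attached : Attached p cs
  weight : ∀ f : V → ℕ, weight f ω = weight f p + (cs.map (weight f)).sum

theorem isWalk_append_singleton {G : Digraph V} {ω : List V} (h : ω ≠ []) {v : V} :
    IsWalk G (ω ++ [v]) ↔ IsWalk G ω ∧ ∀ l ∈ ω.getLast?, G.Adj l v := by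
  simp [IsWalk, List.isChain_append, h]

/-- Adding back the source turns the weight into a plain sum over all vertices, which is easy to
compare after a splice. -/
theorem weight_add {f : V → ℕ} {ω : List V} {a : V} (h : ω.head? = some a) :
    WordMix.weight f ω + f a = (ω.map f).sum := by
  cases ω with
  | nil => simp at h
  | cons b ω =>
    simp only [List.head?_cons, Option.some.injEq] at h
    subst h
    simp [WordMix.weight, add_comm]

theorem IsDecomposition.extend {G : Digraph V} {ω p : List V} {cs : List (List V)}
    (h : IsDecomposition G ω p cs) {v : V} (hω : ω ≠ []) (hv : ∀ l ∈ ω.getLast?, G.Adj l v)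
    (hp : v ∉ p) : IsDecomposition G (ω ++ [v]) (p ++ [v]) cs where
  isPath := ⟨(isWalk_append_singleton h.isPath.1.1).2 ⟨h.isPath.1, h.last ▸ hv⟩, by
    rw [List.nodup_append]
    exact ⟨h.isPath.2, by simp, by rintro a ha b hb rfl; simp at hb; exact hp (hb ▸ ha)⟩⟩
  head := by simp [List.head?_append, h.head]
  last := by simp
  isCycle := h.isCycle
  attached := h.attached.mono (by simp +contextual)
  weight f := by
    rw [weight_append f hω, weight_append f h.isPath.1.1, h.weight f]
    omega

theorem IsDecomposition.close {G : Digraph V} {ω l r : List V} {cs : List (List V)} {v : V}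
    (h : IsDecomposition G ω (l ++ v :: r) cs) (hω : ω ≠ [])
    (hv : ∀ l ∈ ω.getLast?, G.Adj l v) :
    IsDecomposition G (ω ++ [v]) (l ++ [v]) (cs ++ [v :: r ++ [v] ]) := by
  have hchain := h.isPath.1.2
  have hnodup := h.isPath.2
  rw [List.append_cons] at hchain hnodup
  have hlast : (v :: r).getLast? = ω.getLast? := by
    rw [← h.last, List.getLast?_append]
    simp [List.getLast?_cons]
  refine ⟨⟨⟨by simp, (List.isChain_append.1 hchain).1⟩, (List.nodup_append.1 hnodup).1⟩, ?_, by simp,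
    ?_, ?_, ?_⟩
  · rw [List.head?_append (l := ω), ← h.head]
    cases l <;> simp
  · intro γ hγ
    rw [List.mem_append, List.mem_singleton] at hγ
    rcases hγ with hγ | rfl
    · exact h.isCycle γ hγ
    · refine ⟨(isWalk_append_singleton (by simp)).2 ⟨⟨by simp, ?_⟩, hlast ▸ hv⟩, v, r, rfl, ?_⟩
      · exact (List.isChain_append.1 h.isPath.1.2).2.1
      · exact (List.nodup_append.1 h.isPath.2).2.1
  · refine h.attached.append_singleton (v := v) ?_ (by simp) (by simp)
    intro a
    simp only [List.mem_append, List.mem_cons]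
    tauto
  · intro f
    rw [weight_append f hω, h.weight f, List.append_cons, weight_append f (by simp)]
    simp [WordMix.weight]
    omega

theorem isDecomposition_dec [DecidableEq V] {G : Digraph V} {ω : List V} (h : IsWalk G ω) :
    IsDecomposition G ω (dec ω).1 (dec ω).2 := by
  induction ω using List.reverseRecOn with
  | nil => exact absurd rfl h.1
  | append_singleton ω v ih =>
    rcases eq_or_ne ω [] with rfl | h0
    · exact ⟨⟨h, by simp [dec]⟩, rfl, rfl, by simp [dec], .nil, fun f => by simp [dec]⟩
    · have hd : dec (ω ++ [v]) = decStep (dec ω) v := by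
        cases ω with
        | nil => simp at h0
        | cons a ω => simp [dec, List.foldl_append]
      rw [isWalk_append_singleton h0] at h
      have ih := ih h.1
      rw [hd]
      rw [decStep]
      split_ifs with hv
      · have hsplit := List.takeWhile_append_dropWhile (p := fun x => x ≠ v) (l := (dec ω).1)
        have hdrop : ∃ r, (dec ω).1.dropWhile (fun x => x ≠ v) = v :: r := by
          have hne : (dec ω).1.dropWhile (fun x => x ≠ v) ≠ [] := by
            rw [Ne, List.dropWhile_eq_nil_iff]
            exact fun hall => by simpa using hall v hv
          have := List.head_dropWhile_not (fun x => decide (x ≠ v)) hne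
          refine ⟨((dec ω).1.dropWhile (fun x => x ≠ v)).tail, ?_⟩
          rw [← List.cons_head_tail hne]
          congr 1
          simpa using this
        obtain ⟨r, hr⟩ := hdrop
        rw [hr] at hsplit ⊢
        rw [← hsplit] at ih
        exact ih.close h0 h.2
      · exact ih.extend h0 h.2 hv

/-- An occurrence of `v` is replaced by the closed walk `γ` from `v` to `v`. A weight omits the
source, so this adds exactly the weight of `γ`. -/
theorem exists_splice {G : Digraph V} {ω γ : List V} (hω : IsWalk G ω) (hγ : IsCycle G γ)
    {v : V} (hv : γ.head? = some v) (hvω : v ∈ ω) :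
    ∃ ω', IsWalk G ω' ∧ ω'.head? = ω.head? ∧ (∀ a ∈ ω, a ∈ ω') ∧ (∀ a ∈ γ, a ∈ ω') ∧
      ∀ f, weight f ω' = weight f ω + weight f γ := by
  obtain ⟨l, r, rfl⟩ := List.append_of_mem hvω
  obtain ⟨hγ, v', q, rfl, -⟩ := hγ
  obtain rfl : v' = v := by simpa using hv
  have hhead : (l ++ ((v' :: q) ++ v' :: r)).head? = (l ++ v' :: r).head? := by
    cases l <;> simp
  refine ⟨l ++ ((v' :: q) ++ v' :: r), ⟨by simp, ?_⟩, hhead, ?_, ?_, ?_⟩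
  · have h1 := List.isChain_append.1 hω.2
    have h2 := List.isChain_append.1 hγ.2
    rw [List.isChain_append, List.isChain_append]
    refine ⟨h1.1, ⟨h2.1, h1.2.1, ?_⟩, ?_⟩
    · simpa using h2.2.2
    · simpa using h1.2.2
  · intro a
    simp only [List.mem_append, List.mem_cons]
    tauto
  · intro a
    simp only [List.mem_append, List.mem_cons]
    simp
    tauto
  · intro f
    obtain ⟨a, ha⟩ : ∃ a, (l ++ v' :: r).head? = some a := by cases l <;> simp
    have e1 := weight_add (f := f) ha
    have e2 := weight_add (f := f) (hhead.trans ha)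
    have e3 := weight_add (f := f) hv
    simp only [List.map_append, List.map_cons, List.sum_append, List.sum_cons, List.map_nil,
      List.sum_nil] at e1 e2 e3
    simp only [List.cons_append] at *
    omega

theorem exists_splice_many {G : Digraph V} {ω γ : List V} (hω : IsWalk G ω) (hγ : IsCycle G γ)
    {v : V} (hv : γ.head? = some v) (hvω : v ∈ ω) (n : ℕ) :
    ∃ ω', IsWalk G ω' ∧ ω'.head? = ω.head? ∧ (∀ a ∈ ω, a ∈ ω') ∧ (n ≠ 0 → ∀ a ∈ γ, a ∈ ω') ∧
      ∀ f, weight f ω' = weight f ω + n * weight f γ := by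
  induction n with
  | zero => exact ⟨ω, hω, rfl, fun _ => id, by simp, by simp⟩
  | succ n ih =>
    obtain ⟨ω₁, h1, h2, h3, -, h5⟩ := ih
    obtain ⟨ω₂, k1, k2, k3, k4, k5⟩ := exists_splice h1 hγ hv (h3 v hvω)
    exact ⟨ω₂, k1, k2.trans h2, fun a ha => k3 a (h3 a ha), fun _ => k4,
      fun f => by rw [k5, h5]; ring⟩

/-- The cycles attached to a path can be traversed any positive number of times. -/
theorem Attached.exists_walk [DecidableEq V] {G : Digraph V} {p : List V} {cs : List (List V)}
    (h : Attached p cs) (hp : IsWalk G p) (hc : ∀ γ ∈ cs, IsCycle G γ) (m : List V → ℕ)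
    (hm : ∀ γ ∈ cs, m γ ≠ 0) :
    ∃ ω, IsWalk G ω ∧ ω.head? = p.head? ∧ (∀ a ∈ p, a ∈ ω) ∧ (∀ γ ∈ cs, ∀ a ∈ γ, a ∈ ω) ∧
      ∀ f, weight f ω = weight f p + ∑ γ ∈ cs.toFinset, m γ * weight f γ := by
  induction h with
  | nil => exact ⟨p, hp, rfl, fun _ => id, by simp, by simp⟩
  | @cons γ cs v hγ hv _ ih =>
    -- The later cycles are inserted first, so the vertex on which `γ` hangs is already on `ω`.
    obtain ⟨ω, h1, h2, h3, h4, h5⟩ := ih (fun δ hδ => hc δ (by simp [hδ]))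
      (fun δ hδ => hm δ (by simp [hδ]))
    -- The sum runs over distinct cycles: a cycle that occurs again later already has its full
    -- multiplicity.
    by_cases hmem : γ ∈ cs
    · refine ⟨ω, h1, h2, h3, ?_, ?_⟩
      · intro δ hδ
        rcases List.mem_cons.1 hδ with rfl | hδ
        · exact h4 _ hmem
        · exact h4 _ hδ
      · intro f
        rw [h5, List.toFinset_cons, Finset.insert_eq_of_mem (by simpa using hmem)]
    · have hvω : v ∈ ω := by
        rcases hv with hv | ⟨δ, hδ, hv⟩
        · exact h3 v hv
        · exact h4 δ hδ v hv
      obtain ⟨ω', k1, k2, k3, k4, k5⟩ :=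
        exists_splice_many h1 (hc γ (by simp)) hγ hvω (m γ)
      refine ⟨ω', k1, k2.trans h2, fun a ha => k3 a (h3 a ha), ?_, ?_⟩
      · intro δ hδ
        rcases List.mem_cons.1 hδ with rfl | hδ
        · exact k4 (hm _ (by simp))
        · exact fun a ha => k3 a (h4 δ hδ a ha)
      · intro f
        rw [k5, h5, List.toFinset_cons, Finset.sum_insert (by simpa using hmem)]
        ring

theorem IsCycle.not_nodup {G : Digraph V} {γ : List V} (h : IsCycle G γ) : ¬ γ.Nodup := by
  obtain ⟨-, v, p, rfl, -⟩ := h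
  simp

theorem IsPath.length_le [Fintype V] {G : Digraph V} {p : List V} (h : IsPath G p) :
    p.length ≤ Fintype.card V :=
  h.2.length_le_card

theorem IsCycle.length_le [Fintype V] {G : Digraph V} {γ : List V} (h : IsCycle G γ) :
    γ.length ≤ Fintype.card V + 1 := by
  obtain ⟨-, v, p, rfl, h⟩ := h
  have := h.length_le_card
  simp only [List.length_append, List.length_singleton]
  omega

theorem trace_eq [DecidableEq V] (ω : List V) :
    trace ω = {(dec ω).1} ∪ {γ | γ ∈ (dec ω).2} := by
  ext x
  simp only [trace, multiTrace, Set.mem_ofPred_eq, Set.mem_union, Set.mem_singleton_iff]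
  rw [Ne, Nat.add_eq_zero_iff, not_and_or, List.count_eq_zero]
  simp

/-- Paths and cycles have bounded length, so all traces are subsets of one finite set of lists. -/
theorem finite_traces [DecidableEq V] [Finite V] (G : Digraph V) : (traces G).Finite := by
  cases nonempty_fintype V
  refine (List.finite_length_le V (Fintype.card V + 1)).finite_subsets.subset ?_
  rintro T ⟨ω, hω, rfl⟩
  have h := isDecomposition_dec hω
  rw [trace_eq]
  rintro x (rfl | hx)
  · exact h.isPath.length_le.trans (Nat.le_succ _)
  · exact (h.isCycle x hx).length_le

theorem IsWalk.exists_enumerates [DecidableEq V] {G : Digraph V} {ω : List V} (h : IsWalk G ω) :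
    Enumerates G (trace ω) (dec ω).1 (dec ω).2.dedup :=
  have hd := isDecomposition_dec h
  ⟨hd.isPath, fun γ hγ => hd.isCycle γ (List.mem_dedup.1 hγ), List.nodup_dedup _, by
    simp [trace_eq]⟩

/-- A cycle repeats a vertex and a path does not, so the bare set determines which element is the
path and which are the cycles. -/
theorem Enumerates.eq_of_trace [DecidableEq V] {G : Digraph V} {ω : List V} (h : IsWalk G ω)
    {π : List V} {γs : List (List V)} (he : Enumerates G (trace ω) π γs) :
    π = (dec ω).1 ∧ γs.toFinset = (dec ω).2.toFinset := by
  have hd := isDecomposition_dec h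
  obtain ⟨hπ, hγ, -, he⟩ := he
  rw [trace_eq] at he
  have hiff : ∀ x, (x = (dec ω).1 ∨ x ∈ (dec ω).2) ↔ (x = π ∨ x ∈ γs) :=
    fun x => Set.ext_iff.1 he x
  constructor
  · rcases (hiff π).2 (.inl rfl) with h | h
    · exact h
    · exact absurd hπ.2 (hd.isCycle _ h).not_nodup
  · ext x
    simp only [List.mem_toFinset]
    constructor
    · intro hx
      rcases (hiff x).2 (.inr hx) with h | h
      · exact absurd (h ▸ hd.isPath.2) (hγ x hx).not_nodup
      · exact h
    · intro hx
      rcases (hiff x).1 (.inr hx) with h | h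
      · exact absurd (h ▸ hπ.2) (hd.isCycle x hx).not_nodup
      · exact h

end Decomposition

/-! ### Zero-sum partitions and small solutions of linear systems -/

section ZeroSum

/-- Integers bounded by `M` can be arranged such that all partial sums are bounded by `M`. -/
theorem exists_arrangement {E : Type*} (f : E → ℤ) (M : ℤ) (S : Multiset E)
    (hS : ∀ e ∈ S, |f e| ≤ M) (c : ℤ) (hc : |c| ≤ M) (h : c + (S.map f).sum = 0) :
    ∃ l : List E, (l : Multiset E) = S ∧ ∀ n, |c + ((l.take n).map f).sum| ≤ M := by
  classical
  induction hn : Multiset.card S generalizing S c with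
  | zero =>
    rw [Multiset.card_eq_zero] at hn
    subst hn
    exact ⟨[], rfl, by simpa using hc⟩
  | succ n ih =>
    -- A nonnegative term is safe when `c ≤ 0`, a negative one when `c > 0`. If no safe term
    -- existed, the total could not be zero.
    have key : ∃ e ∈ S, |c + f e| ≤ M := by
      by_contra! hcon
      have hne : S ≠ 0 := by rintro rfl; simp at hn
      rcases le_or_gt c 0 with h0 | h0
      · have hneg : ∀ e ∈ S, f e < 0 := by
          intro e he
          by_contra! hpos
          have h1 := hcon e he
          have h2 := hS e he
          rw [abs_le] at h2 hc
          rw [lt_abs] at h1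
          omega
        have : (S.map f).sum < (S.map fun _ => (0 : ℤ)).sum :=
          Multiset.sum_lt_sum_of_nonempty hne hneg
        simp at this
        omega
      · have hpos : ∀ e ∈ S, 0 ≤ f e := by
          intro e he
          by_contra! hneg
          have h1 := hcon e he
          have h2 := hS e he
          rw [abs_le] at h2 hc
          rw [lt_abs] at h1
          omega
        have : 0 ≤ (S.map f).sum := Multiset.sum_nonneg (by
          intro x hx
          obtain ⟨e, he, rfl⟩ := Multiset.mem_map.1 hx
          exact hpos e he)
        omega
    obtain ⟨e, he, hce⟩ := key
    obtain ⟨T, rfl⟩ := Multiset.exists_cons_of_mem he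
    obtain ⟨l, hl, hl'⟩ := ih T (fun a ha => hS a (by simp [ha])) (c + f e) hce
      (by simpa [add_assoc] using h) (by simpa using hn)
    refine ⟨e :: l, by rw [← hl]; rfl, ?_⟩
    rintro (_ | k)
    · simpa using hc
    · simpa [add_assoc] using hl' k

/-- A zero-sum multiset of integers bounded by `M` splits into zero-sum parts of size at most
`2 * M + 1`. -/
theorem exists_partition_of_sum_eq_zero {E : Type*} (f : E → ℤ) (M : ℕ) (S : Multiset E)
    (hS : ∀ e ∈ S, |f e| ≤ M) (h : (S.map f).sum = 0) :
    ∃ P : Multiset (Multiset E), P.join = S ∧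
      ∀ B ∈ P, (B.map f).sum = 0 ∧ Multiset.card B ≤ 2 * M + 1 := by
  classical
  induction hn : Multiset.card S using Nat.strong_induction_on generalizing S with
  | _ n ih =>
    rcases le_or_gt n (2 * M + 1) with hle | hgt
    · exact ⟨{S}, by simp, by simpa [h, hn] using hle⟩
    obtain ⟨l, rfl, hl⟩ := exists_arrangement f M S hS 0 (by simp) (by simpa using h)
    simp only [zero_add] at hl
    -- The first `2 * M + 2` partial sums take at most `2 * M + 1` values in `[-M, M]`. Two equal
    -- ones enclose a zero-sum block of length at most `2 * M + 1`, which is split off.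
    obtain ⟨i, hi, j, hj, hij, heq⟩ : ∃ i ∈ Finset.range (2 * M + 2),
        ∃ j ∈ Finset.range (2 * M + 2), i ≠ j ∧
          ((l.take i).map f).sum = ((l.take j).map f).sum := by
      refine Finset.exists_ne_map_eq_of_card_lt_of_maps_to (t := Finset.Icc (-(M : ℤ)) M) ?_ ?_
      · simp; omega
      · intro i _
        simpa [abs_le] using hl i
    wlog hlt : i < j generalizing i j
    · exact this j hj i hi hij.symm heq.symm (by omega)
    simp only [Finset.mem_range] at hi hj
    simp only [Multiset.coe_card] at hn
    have hsplit : l = l.take i ++ ((l.take j).drop i ++ l.drop j) := by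
      conv_lhs => rw [← List.take_append_drop j l, ← List.take_append_drop i (l.take j)]
      rw [List.take_take, min_eq_left hlt.le, List.append_assoc]
    have hmid : (((l.take j).drop i).map f).sum = 0 := by
      have : ((l.take j).map f).sum = ((l.take i).map f).sum + (((l.take j).drop i).map f).sum := by
        conv_lhs => rw [← List.take_append_drop i (l.take j)]
        rw [List.take_take, min_eq_left hlt.le, List.map_append, List.sum_append]
      omega
    have hlen : ((l.take j).drop i).length = j - i := by
      rw [List.length_drop, List.length_take]; omega
    set B := (l.take j).drop i
    have hperm : (l : Multiset E) = (B : Multiset E) + (l.take i ++ l.drop j : List E) := by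
      conv_lhs => rw [hsplit]
      rw [Multiset.coe_add, Multiset.coe_eq_coe]
      exact List.perm_append_comm_assoc _ _ _
    have hcard := congrArg Multiset.card hperm
    rw [hperm] at hS h
    simp only [Multiset.coe_card, Multiset.card_add] at hcard
    obtain ⟨P, hP, hP'⟩ := ih (l.take i ++ l.drop j).length (by omega) _
      (fun e he => hS e (Multiset.mem_add.2 (.inr he)))
      (by
        rw [Multiset.map_add, Multiset.sum_add, Multiset.map_coe, Multiset.sum_coe, hmid,
          zero_add] at h
        exact h) (by simp)
    refine ⟨(B : Multiset E) ::ₘ P, by rw [Multiset.join_cons, hP, hperm], ?_⟩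
    intro C hC
    rcases Multiset.mem_cons.1 hC with rfl | hC
    · refine ⟨by simpa using hmid, ?_⟩
      simp only [Multiset.coe_card]
      omega
    · exact hP' C hC

theorem sum_map_join {E : Type*} (f : E → ℤ) (P : Multiset (Multiset E)) :
    (P.join.map f).sum = (P.map fun B => (B.map f).sum).sum := by
  induction P using Multiset.induction_on with
  | empty => simp
  | cons B P ih => simp

theorem abs_sum_map_le {E : Type*} (f : E → ℤ) (M : ℤ) (B : Multiset E)
    (h : ∀ e ∈ B, |f e| ≤ M) : |(B.map f).sum| ≤ Multiset.card B * M := by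
  induction B using Multiset.induction_on with
  | empty => simp
  | cons a B ih =>
    have h1 := h a (by simp)
    have h2 := ih fun e he => h e (by simp [he])
    have h3 := abs_add_le (f a) (B.map f).sum
    simp only [Multiset.map_cons, Multiset.sum_cons, Multiset.card_cons]
    push_cast
    linarith

theorem card_join_le {E : Type*} (P : Multiset (Multiset E)) (k : ℕ)
    (h : ∀ B ∈ P, Multiset.card B ≤ k) : Multiset.card P.join ≤ Multiset.card P * k := by
  induction P using Multiset.induction_on with
  | empty => simp
  | cons B P ih =>
    have h1 := h B (by simp)
    have h2 := ih fun e he => h e (by simp [he])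
    simp only [Multiset.join_cons, Multiset.card_add, Multiset.card_cons]
    linarith

/-- A multiset on which finitely many functions bounded by `M` sum up to zero splits into parts of
bounded size with the same property. -/
theorem exists_partition_of_forall_sum_eq_zero {E : Type*} (fs : List (E → ℤ)) (M : ℕ)
    (S : Multiset E) (hS : ∀ f ∈ fs, ∀ e ∈ S, |f e| ≤ M) (h : ∀ f ∈ fs, (S.map f).sum = 0) :
    ∃ P : Multiset (Multiset E), P.join = S ∧ ∀ B ∈ P, (∀ f ∈ fs, (B.map f).sum = 0) ∧
      Multiset.card B ≤ (2 * M + 1) ^ 3 ^ fs.length := by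
  induction hk : fs.length generalizing E M with
  | zero =>
    rw [List.length_eq_zero_iff] at hk
    subst hk
    refine ⟨S.map fun e => {e}, ?_, ?_⟩
    · induction S using Multiset.induction_on with
      | empty => simp
      | cons a S ih => simp [ih]
    · intro B hB
      obtain ⟨e, -, rfl⟩ := Multiset.mem_map.1 hB
      simp
  | succ k ih =>
    obtain ⟨f, gs, rfl⟩ := List.exists_cons_of_length_eq_add_one hk
    obtain ⟨P, rfl, hP⟩ := exists_partition_of_sum_eq_zero f M S (hS f (by simp)) (h f (by simp))
    -- The zero-sum blocks for `f` become the elements of a new multiset. Each has at most `2 * M +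
    -- 1` members, so the other sums are bounded on it by `M * (2 * M + 1)`.
    obtain ⟨Q, rfl, hQ⟩ := ih (gs.map fun g B => (Multiset.map g B).sum) (M * (2 * M + 1)) P
      (by
        intro g' hg' B hB
        obtain ⟨g, hg, rfl⟩ := List.mem_map.1 hg'
        refine (abs_sum_map_le g M B fun e he => hS g (by simp [hg]) e
          (Multiset.mem_join.2 ⟨B, hB, he⟩)).trans ?_
        push_cast
        rw [mul_comm]
        gcongr
        exact_mod_cast (hP B hB).2)
      (by
        intro g' hg'
        obtain ⟨g, hg, rfl⟩ := List.mem_map.1 hg'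
        rw [← sum_map_join]
        exact h g (by simp [hg]))
      (by simpa using hk)
    refine ⟨Q.map Multiset.join, ?_, ?_⟩
    · clear ih h hS hP hQ
      induction Q using Multiset.induction_on with
      | empty => simp
      | cons C Q ih => simp [ih]
    · intro B hB
      obtain ⟨C, hC, rfl⟩ := Multiset.mem_map.1 hB
      have hCP : ∀ B ∈ C, B ∈ Q.join := fun B hB => Multiset.mem_join.2 ⟨C, hC, hB⟩
      constructor
      · intro g hg
        rw [sum_map_join]
        rcases List.mem_cons.1 hg with rfl | hg
        · rw [Multiset.map_congr rfl fun B hB => (hP B (hCP B hB)).1]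
          simp
        · exact (hQ C hC).1 _ (List.mem_map.2 ⟨g, hg, rfl⟩)
      · refine (card_join_le C (2 * M + 1) fun B hB => (hP B (hCP B hB)).2).trans ?_
        -- Since `2M(2M+1) + 1 ≤ (2M+1)²`, the exponents add up to `2·3^k + 3^k = 3^(k+1)`.
        calc Multiset.card C * (2 * M + 1)
            ≤ (2 * (M * (2 * M + 1)) + 1) ^ 3 ^ k * (2 * M + 1) ^ 3 ^ k := by
              gcongr
              · exact (hQ C hC).2
              · exact Nat.le_self_pow (by positivity) _
          _ ≤ ((2 * M + 1) ^ 2) ^ 3 ^ k * (2 * M + 1) ^ 3 ^ k := by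
              gcongr
              nlinarith
          _ = (2 * M + 1) ^ 3 ^ (k + 1) := by
              rw [← pow_mul, ← pow_add]
              ring_nf

theorem sum_map_option {E : Type*} [DecidableEq E] (f : E → ℤ) (a : ℤ)
    (B : Multiset (Option E)) :
    (B.map fun o => o.elim a f).sum = ((B.filterMap id).map f).sum + B.count none * a := by
  induction B using Multiset.induction_on with
  | empty => simp
  | cons o B ih =>
    cases o with
    | none => simp [ih]; ring
    | some e => simp [ih]; ring

theorem card_filterMap_le {E F : Type*} (f : E → Option F) (B : Multiset E) :
    Multiset.card (B.filterMap f) ≤ Multiset.card B := by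
  induction B using Quotient.inductionOn with
  | _ l => simpa using List.length_filterMap_le f l

theorem filterMap_join {E F : Type*} (f : E → Option F) (P : Multiset (Multiset E)) :
    P.join.filterMap f = (P.map (Multiset.filterMap f)).join := by
  induction P using Multiset.induction_on with
  | empty => simp
  | cons B P ih => simp [Multiset.filterMap_add, ih]

theorem filterMap_id_map_some {E : Type*} (S : Multiset E) :
    (S.map some).filterMap id = S := by
  rw [Multiset.filterMap_map]
  exact Multiset.filterMap_some S

/-- Slack variables: `s` copies of `none`, with value `-1` under `g` and `0` under `fs`, turn the
inequality into an equation. Within a zero-sum block, the sum of `g` over the genuine elements is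
the number of slack elements, hence nonnegative. -/
theorem exists_partition_of_sum_nonneg {E : Type*} (fs : List (E → ℤ)) (g : E → ℤ) (M : ℕ)
    (hM : 1 ≤ M) (S : Multiset E) (hS : ∀ f ∈ fs, ∀ e ∈ S, |f e| ≤ M) (hg : ∀ e ∈ S, |g e| ≤ M)
    (h : ∀ f ∈ fs, (S.map f).sum = 0) (h' : 0 ≤ (S.map g).sum) :
    ∃ P : Multiset (Multiset E), P.join = S ∧ ∀ B ∈ P, (∀ f ∈ fs, (B.map f).sum = 0) ∧
      0 ≤ (B.map g).sum ∧ Multiset.card B ≤ (2 * M + 1) ^ 3 ^ (fs.length + 1) := by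
  classical
  obtain ⟨s, hs⟩ := Int.eq_ofNat_of_zero_le h'
  have hsum : ∀ (f : E → ℤ) (a : ℤ), ((S.map some + Multiset.replicate s none).map
      fun o : Option E => o.elim a f).sum = (S.map f).sum + s * a := by
    intro f a
    rw [Multiset.map_add, Multiset.sum_add, Multiset.map_map]
    simp [Function.comp_def]
  obtain ⟨P, hP, hP'⟩ := exists_partition_of_forall_sum_eq_zero
    ((fun o : Option E => o.elim (-1) g) :: fs.map fun f o => o.elim 0 f) M
    (S.map some + Multiset.replicate s none)
    (by
      intro f hf o ho
      have ho' : o = none ∨ ∃ e ∈ S, o = some e := by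
        rcases Multiset.mem_add.1 ho with ho | ho
        · obtain ⟨e, he, rfl⟩ := Multiset.mem_map.1 ho
          exact .inr ⟨e, he, rfl⟩
        · exact .inl (Multiset.eq_of_mem_replicate ho)
      rcases List.mem_cons.1 hf with rfl | hf
      · rcases ho' with rfl | ⟨e, he, rfl⟩
        · simpa using hM
        · exact hg e he
      · obtain ⟨f, hff, rfl⟩ := List.mem_map.1 hf
        rcases ho' with rfl | ⟨e, he, rfl⟩
        · simp
        · exact hS f hff e he)
    (by
      intro f hf
      rcases List.mem_cons.1 hf with rfl | hf
      · rw [hsum, hs]; simp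
      · obtain ⟨f, hff, rfl⟩ := List.mem_map.1 hf
        rw [hsum, h f hff]; simp)
  refine ⟨P.map (Multiset.filterMap id), ?_, ?_⟩
  · rw [← filterMap_join, hP, Multiset.filterMap_add, filterMap_id_map_some]
    convert add_zero S
    rw [Multiset.eq_zero_iff_forall_notMem]
    intro e he
    obtain ⟨o, ho, rfl⟩ := (Multiset.mem_filterMap _ _).1 he
    have := Multiset.eq_of_mem_replicate ho
    simp_all
  · intro B hB
    obtain ⟨C, hC, rfl⟩ := Multiset.mem_map.1 hB
    obtain ⟨h1, h2⟩ := hP' C hC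
    refine ⟨fun f hf => ?_, ?_, (card_filterMap_le _ _).trans (by simpa using h2)⟩
    · have := h1 _ (List.mem_cons_of_mem _ (List.mem_map_of_mem hf))
      rw [sum_map_option] at this
      simpa using this
    · have := h1 _ List.mem_cons_self
      rw [sum_map_option] at this
      have : 0 ≤ (Multiset.count none C : ℤ) := by positivity
      omega

/-- If a system of linear equations and one strict linear inequality with coefficients bounded by
`M` holds for a multiset, then it holds for one of bounded size over the same elements. -/
theorem exists_small_solution {E : Type*} (fs : List ((E → ℤ) × ℤ)) (g : E → ℤ) (c : ℤ) (M : ℕ)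
    (hM : 1 ≤ M) (S : Multiset E) (hS : ∀ f ∈ fs, ∀ e ∈ S, |f.1 e| ≤ M)
    (hS' : ∀ f ∈ fs, |f.2| ≤ M) (hg : ∀ e ∈ S, |g e| ≤ M) (hc : |c - 1| ≤ M)
    (h : ∀ f ∈ fs, f.2 + (S.map f.1).sum = 0) (h' : 0 < c + (S.map g).sum) :
    ∃ T : Multiset E, (∀ e ∈ T, e ∈ S) ∧ (∀ f ∈ fs, f.2 + (T.map f.1).sum = 0) ∧
      0 < c + (T.map g).sum ∧ Multiset.card T ≤ (2 * M + 1) ^ 3 ^ (fs.length + 1) := by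
  classical
  have hmem : ∀ o : Option E, o ∈ none ::ₘ S.map some → o = none ∨ ∃ e ∈ S, o = some e := by
    intro o ho
    rcases Multiset.mem_cons.1 ho with rfl | ho
    · exact .inl rfl
    · obtain ⟨e, he, rfl⟩ := Multiset.mem_map.1 ho
      exact .inr ⟨e, he, rfl⟩
  have hsum : ∀ (f : E → ℤ) (a : ℤ), ((none ::ₘ S.map some).map
      fun o : Option E => o.elim a f).sum = a + (S.map f).sum := by
    intro f a
    rw [Multiset.map_cons, Multiset.sum_cons, Multiset.map_map]
    simp [Function.comp_def]
  -- Homogenization: one extra element `none` carries the constant terms. Over the integers the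
  -- strict inequality says that `c - 1` plus the sum is nonnegative.
  obtain ⟨P, hP, hP'⟩ := exists_partition_of_sum_nonneg
    (fs.map fun f (o : Option E) => o.elim f.2 f.1) (fun o : Option E => o.elim (c - 1) g) M hM
    (none ::ₘ S.map some)
    (by
      intro f hf o ho
      obtain ⟨f, hff, rfl⟩ := List.mem_map.1 hf
      rcases hmem o ho with rfl | ⟨e, he, rfl⟩
      · exact hS' f hff
      · exact hS f hff e he)
    (by
      intro o ho
      rcases hmem o ho with rfl | ⟨e, he, rfl⟩
      · exact hc
      · exact hg e he)
    (by
      intro f hf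
      obtain ⟨f, hff, rfl⟩ := List.mem_map.1 hf
      rw [hsum, h f hff])
    (by rw [hsum]; omega)
  -- The part that contains the single `none` retains the constants exactly once, so its other
  -- elements solve the original system.
  obtain ⟨B, hB, hnone⟩ := Multiset.mem_join.1 (hP ▸ Multiset.mem_cons_self none (S.map some))
  obtain ⟨h1, h2, h3⟩ := hP' B hB
  have hle : B ≤ none ::ₘ S.map some := by
    rw [← hP]
    obtain ⟨Q, rfl⟩ := Multiset.exists_cons_of_mem hB
    simp
  have hcount : B.count none = 1 := by
    have := Multiset.count_le_of_le none hle
    have hpos := Multiset.count_pos.2 hnone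
    simp at this
    omega
  refine ⟨B.filterMap id, ?_, ?_, ?_, (card_filterMap_le _ _).trans (by simpa using h3)⟩
  · intro e he
    obtain ⟨o, ho, ho'⟩ := (Multiset.mem_filterMap _ _).1 he
    obtain rfl : o = some e := ho'
    rcases hmem _ (Multiset.mem_of_le hle ho) with h | ⟨e', he', h⟩
    · simp at h
    · exact (Option.some.inj h) ▸ he'
  · intro f hf
    have := h1 _ (List.mem_map_of_mem hf)
    rw [sum_map_option, hcount] at this
    rw [← this]
    push_cast
    ring
  · rw [sum_map_option, hcount] at h2
    push_cast at h2
    linarith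

end ZeroSum

/-- Settles `N = 0`, where walks do not represent nonempty words. -/
theorem WMIX_eq_univ {A : Type*} {ws : List (List A)} (h : ∀ u ∈ ws, u = []) (w : List A) :
    w ∈ WMIX ws := by
  intro u hu v hv
  rw [h u hu, h v hv]

/-! ### Occurrences in terms of paths and cycle multiplicities -/

section Counting

variable {A : Type*} [DecidableEq A] {N : ℕ}

theorem IsDecomposition.occ_eq {ω p : List (List.Vector A N)}
    {cs : List (List (List.Vector A N))} {G : Digraph (List.Vector A N)} {w u : List A}
    (hd : IsDecomposition G ω p cs) (h : Reads ω w) (hu : u.length ≤ N) :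
    occ u w = pathOcc u p + (cs.map (walkOcc u)).sum := by
  obtain ⟨v, hv⟩ : ∃ v, p.head? = some v :=
    ⟨p.head hd.isPath.1.1, (List.head?_eq_some_head _)⟩
  rw [h.occ u hu, pathOcc_eq hv, pathOcc_eq (hd.head ▸ hv), walkOcc_eq_weight, hd.weight, add_assoc]
  rfl

/-- The cycles of a decomposition can be read any positive number of times. -/
theorem IsDecomposition.exists_word {ω p : List (List.Vector A N)}
    {cs : List (List (List.Vector A N))} (hd : IsDecomposition (deBruijn A N) ω p cs)
    (m : List (List.Vector A N) → ℕ) (hm : ∀ γ ∈ cs, m γ ≠ 0) :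
    ∃ w : List A, w.length = N + (p.length - 1) + ∑ γ ∈ cs.toFinset, m γ * (γ.length - 1) ∧
      ∀ u : List A, u.length ≤ N →
        occ u w = pathOcc u p + ∑ γ ∈ cs.toFinset, m γ * walkOcc u γ := by
  obtain ⟨ω', h1, h2, -, -, h5⟩ := hd.attached.exists_walk hd.isPath.1 hd.isCycle m hm
  obtain ⟨w, hw⟩ := h1.exists_reads
  refine ⟨w, ?_, fun u hu => ?_⟩
  · have e1 := h5 fun _ => 1
    simp only [weight_one] at e1
    have e2 := hw.length
    have e3 := List.length_pos_iff.2 h1.1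
    omega
  · obtain ⟨v, hv⟩ : ∃ v, p.head? = some v :=
      ⟨p.head hd.isPath.1.1, (List.head?_eq_some_head _)⟩
    rw [hw.occ u hu, pathOcc_eq hv, pathOcc_eq (h2.trans hv), walkOcc_eq_weight, h5, add_assoc]
    rfl

end Counting

/-! ### The Presburger sentences and the decision criterion -/

section Presburger

open FirstOrder FirstOrder.Language

variable {A : Type*} [DecidableEq A] {N : ℕ}

theorem isQF_foldr_inf {L : Language} {α : Type*} {n : ℕ} (l : List (L.BoundedFormula α n))
    (h : ∀ φ ∈ l, φ.IsQF) : (l.foldr (· ⊓ ·) ⊤).IsQF := by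
  induction l with
  | nil => exact BoundedFormula.isQF_bot.imp BoundedFormula.isQF_bot
  | cons φ l ih => exact (h φ (by simp)).inf (ih fun ψ hψ => h ψ (by simp [hψ]))

theorem isUniversal_alls {L : Language} {α : Type*} {n : ℕ} {φ : L.BoundedFormula α n}
    (h : φ.IsUniversal) : φ.alls.IsUniversal := by
  induction n with
  | zero => exact h
  | succ n ih => exact ih h.all

theorem isQF_balance (π : List (List.Vector A N)) (γs : List (List (List.Vector A N)))
    (ws : List (List A)) : (balance π γs ws).IsQF := by
  refine isQF_foldr_inf _ fun φ hφ => ?_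
  obtain ⟨u, -, hφ⟩ := List.mem_flatMap.1 hφ
  obtain ⟨v, -, rfl⟩ := List.mem_map.1 hφ
  exact (BoundedFormula.IsAtomic.equal _ _).isQF

theorem isQF_positive (m : ℕ) : (positive m).IsQF := by
  refine isQF_foldr_inf _ fun φ hφ => ?_
  obtain ⟨i, -, rfl⟩ := List.mem_map.1 hφ
  exact (BoundedFormula.IsAtomic.equal _ _).isQF.not

theorem isUniversal_psi (ws ws' : List (List A)) (π : List (List.Vector A N))
    (γs : List (List (List.Vector A N))) : (psi ws ws' π γs).IsUniversal :=
  isUniversal_alls (((isQF_positive _).imp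
    (((isQF_balance π γs ws).imp (isQF_balance π γs ws')).inf
      ((isQF_balance π γs ws').imp (isQF_balance π γs ws)))).isUniversal)

theorem realize_list_sum {α : Type*} (v : α → ℕ) (l : List (Language.presburger.Term α)) :
    l.sum.realize v = (l.map (Term.realize v)).sum := by
  induction l with
  | nil => simp
  | cons t l ih => simp [ih]

theorem realize_theta (π : List (List.Vector A N)) (γs : List (List (List.Vector A N)))
    (u : List A) (e : Empty → ℕ) (xs : Fin γs.length → ℕ) :
    (theta π γs u).realize (Sum.elim e xs) =
      pathOcc u π + ∑ i, xs i * walkOcc u (γs.get i) := by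
  rw [theta, presburger.realize_add, realize_list_sum, presburger.realize_natCast, List.map_map,
    ← List.ofFn_eq_map, List.sum_ofFn]
  simp [presVar, mul_comm]

theorem realize_psi (ws ws' : List (List A)) (π : List (List.Vector A N))
    (γs : List (List (List.Vector A N))) :
    Sentence.Realize ℕ (psi ws ws' π γs) ↔
      ∀ xs : Fin γs.length → ℕ, (∀ i, xs i ≠ 0) →
        ((∀ u ∈ ws, ∀ v ∈ ws, pathOcc u π + ∑ i, xs i * walkOcc u (γs.get i) =
            pathOcc v π + ∑ i, xs i * walkOcc v (γs.get i)) ↔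
          (∀ u ∈ ws', ∀ v ∈ ws', pathOcc u π + ∑ i, xs i * walkOcc u (γs.get i) =
            pathOcc v π + ∑ i, xs i * walkOcc v (γs.get i))) := by
  have hb : ∀ (ws : List (List A)) (e : Empty → ℕ) (xs : Fin γs.length → ℕ),
      (balance π γs ws).Realize e xs ↔
        ∀ u ∈ ws, ∀ v ∈ ws, pathOcc u π + ∑ i, xs i * walkOcc u (γs.get i) =
          pathOcc v π + ∑ i, xs i * walkOcc v (γs.get i) := by
    intro ws e xs
    rw [balance, BoundedFormula.realize_foldr_inf]
    constructor
    · intro h u hu v hv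
      have := h _ (List.mem_flatMap.2 ⟨u, hu, List.mem_map.2 ⟨v, hv, rfl⟩⟩)
      rwa [BoundedFormula.realize_bdEqual, realize_theta, realize_theta] at this
    · intro h φ hφ
      obtain ⟨u, hu, hφ⟩ := List.mem_flatMap.1 hφ
      obtain ⟨v, hv, rfl⟩ := List.mem_map.1 hφ
      rw [BoundedFormula.realize_bdEqual, realize_theta, realize_theta]
      exact h u hu v hv
  rw [Sentence.Realize, psi, BoundedFormula.realize_alls]
  refine forall_congr' fun xs => ?_
  rw [BoundedFormula.realize_imp, BoundedFormula.realize_iff, hb, hb, positive,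
    BoundedFormula.realize_foldr_inf]
  simp [presVar]

theorem WMIX_eq_iff (ws ws' : List (List A)) (hN : N = maxLength (ws ++ ws')) :
    WMIX ws = WMIX ws' ↔
      (∀ w : List A, w.length < N → (w ∈ WMIX ws ↔ w ∈ WMIX ws')) ∧
      ∀ T ∈ traces (deBruijn A N), ∀ (π : List (List.Vector A N))
        (γs : List (List (List.Vector A N))), Enumerates (deBruijn A N) T π γs →
          Sentence.Realize ℕ (psi ws ws' π γs) := by
  have hws : ∀ u ∈ ws, u.length ≤ N := fun u hu =>
    hN ▸ length_le_maxLength (List.mem_append_left _ hu)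
  have hws' : ∀ u ∈ ws', u.length ≤ N := fun u hu =>
    hN ▸ length_le_maxLength (List.mem_append_right _ hu)
  clear hN
  have hmem : ∀ (vs : List (List A)), (∀ u ∈ vs, u.length ≤ N) → ∀ (w : List A) (θ : List A → ℕ),
      (∀ u : List A, u.length ≤ N → occ u w = θ u) →
        (w ∈ WMIX vs ↔ ∀ u ∈ vs, ∀ v ∈ vs, θ u = θ v) := by
    intro vs hvs w θ hθ
    refine forall₂_congr fun u hu => forall₂_congr fun v hv => ?_
    rw [hθ u (hvs u hu), hθ v (hvs v hv)]
  constructor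
  · intro heq
    refine ⟨fun w _ => by rw [heq], ?_⟩
    rintro _ ⟨ω, hω, rfl⟩ π γs he
    rw [realize_psi]
    intro xs hxs
    have hd := isDecomposition_dec hω
    obtain ⟨rfl, hγs⟩ := he.eq_of_trace hω
    have hinj : Function.Injective γs.get := List.nodup_iff_injective_get.1 he.2.2.1
    have himage : (dec ω).2.toFinset = Finset.univ.image γs.get := by
      rw [← hγs]
      ext γ
      simp [List.mem_iff_get]
    -- The values of the variables serve as multiplicities; the default `0` off the enumerated
    -- cycles never enters.
    obtain ⟨w, -, hw⟩ := hd.exists_word (Function.extend γs.get xs 0) (by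
      intro γ hγ
      have : γ ∈ Finset.univ.image γs.get := himage ▸ List.mem_toFinset.2 hγ
      obtain ⟨i, -, rfl⟩ := Finset.mem_image.1 this
      rw [hinj.extend_apply]
      exact hxs i)
    simp only [himage, Finset.sum_image hinj.injOn, hinj.extend_apply] at hw
    rw [← hmem ws hws w _ hw, ← hmem ws' hws' w _ hw, heq]
  · rintro ⟨hshort, hpsi⟩
    ext w
    rcases lt_or_ge w.length N with hlt | hge
    · exact hshort w hlt
    rcases eq_or_ne N 0 with rfl | hN
    · exact iff_of_true (WMIX_eq_univ (fun u hu => by simpa using hws u hu) w)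
        (WMIX_eq_univ (fun u hu => by simpa using hws' u hu) w)
    obtain ⟨ω, hω⟩ := exists_walk_reads hN hge
    have hd := isDecomposition_dec hω.isWalk
    have he := hω.isWalk.exists_enumerates
    -- The sentence is instantiated at the actual multiplicities of the cycles, which are positive.
    have h := (realize_psi _ _ _ _).1 (hpsi _ ⟨ω, hω.isWalk, rfl⟩ _ _ he)
      (fun i => (dec ω).2.count ((dec ω).2.dedup.get i))
      (fun i => (List.count_pos_iff.2 (List.mem_dedup.1 (List.get_mem _ i))).ne')
    have hw : ∀ u : List A, u.length ≤ N → occ u w = pathOcc u (dec ω).1 +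
        ∑ i, (dec ω).2.count ((dec ω).2.dedup.get i) * walkOcc u ((dec ω).2.dedup.get i) := by
      intro u hu
      have hinj : Function.Injective (dec ω).2.dedup.get :=
        List.nodup_iff_injective_get.1 (List.nodup_dedup _)
      rw [hd.occ_eq hω hu, Finset.sum_list_map_count,
        show (dec ω).2.toFinset = Finset.univ.image (dec ω).2.dedup.get by
          ext γ
          rw [List.mem_toFinset, ← List.mem_dedup]; simp [List.mem_iff_get],
        Finset.sum_image hinj.injOn]
      simp only [smul_eq_mul]
      congr!
    rw [hmem ws hws w _ hw, hmem ws' hws' w _ hw]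
    exact h

end Presburger

/-! ### Bounded length of separating words -/

section Witness

/-- A bound on the coefficients of the linear system of a trace in a graph with `v` vertices. -/
def coeffBound (v N : ℕ) : ℕ := N + 2 + v + v * (v + 1) ^ (v + 1)

/-- A bound on the length of a word that separates two languages, for `v = |A| ^ N` and `k` words in
the first list. -/
def witnessBound (v N k : ℕ) : ℕ :=
  coeffBound v N + v * (2 * coeffBound v N + 1) ^ 3 ^ (k * k + 1)

/-- A list of length at most `n` is determined by its `n` optional entries. -/
theorem card_le_of_length_le {V : Type*} [Fintype V] (D : Finset (List V)) (n : ℕ)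
    (h : ∀ γ ∈ D, γ.length ≤ n) : D.card ≤ (Fintype.card V + 1) ^ n := by
  classical
  have hinj : Set.InjOn (fun (γ : List V) (i : Fin n) => γ[(i : ℕ)]?) D := by
    intro γ hγ δ hδ heq
    refine List.ext_getElem? fun i => ?_
    rcases lt_or_ge i n with hi | hi
    · exact congrFun heq ⟨i, hi⟩
    · rw [List.getElem?_eq_none ((h γ hγ).trans hi), List.getElem?_eq_none ((h δ hδ).trans hi)]
  calc D.card ≤ (Finset.univ : Finset (Fin n → Option V)).card :=
        Finset.card_le_card_of_injOn _ (fun _ _ => Finset.mem_univ _) hinj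
    _ = (Fintype.card V + 1) ^ n := by simp

theorem sum_one_add_count_mul {E : Type*} [DecidableEq E] (D : Finset E) (T : Multiset E)
    (hT : ∀ e ∈ T, e ∈ D) (f : E → ℕ) :
    ∑ e ∈ D, (1 + T.count e) * f e = ∑ e ∈ D, f e + (T.map f).sum := by
  simp only [add_mul, one_mul, Finset.sum_add_distrib]
  congr 1
  rw [Finset.sum_multiset_map_count]
  symm
  refine Finset.sum_subset (fun e he => hT e (Multiset.mem_toFinset.1 he)) fun e _ he => ?_
  rw [Multiset.count_eq_zero_of_notMem (by simpa using he), zero_smul]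

theorem sum_map_sub {E : Type*} (f g : E → ℕ) (T : Multiset E) :
    (T.map fun e => (f e : ℤ) - g e).sum = ((T.map f).sum : ℕ) - ((T.map g).sum : ℕ) := by
  induction T using Multiset.induction_on with
  | empty => simp
  | cons a T ih => simp [ih]; ring

variable {A : Type*} [DecidableEq A] [Fintype A] {N : ℕ}

/-- Each cycle is kept once, which preserves the trace's supply of vertices; only the surplus
multiplicities are replaced by a small solution of the same system. -/
theorem exists_short_witness (hN : N ≠ 0) {ws ws' : List (List A)} (hws : ∀ u ∈ ws, u.length ≤ N)
    (hws' : ∀ u ∈ ws', u.length ≤ N) {w : List A} (hw : w ∈ WMIX ws) (hw' : w ∉ WMIX ws') :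
    ∃ w' : List A, w'.length ≤ witnessBound (Fintype.card A ^ N) N ws.length ∧ w' ∈ WMIX ws ∧
      w' ∉ WMIX ws' := by
  classical
  rcases lt_or_ge w.length N with hlt | hge
  · refine ⟨w, ?_, hw, hw'⟩
    rw [witnessBound, coeffBound]
    omega
  obtain ⟨x, hx, y, hy, hxy⟩ : ∃ x ∈ ws', ∃ y ∈ ws', occ y w < occ x w := by
    by_contra! hcon
    exact hw' fun u hu v hv => le_antisymm (hcon u hu v hv) (hcon v hv u hu)
  obtain ⟨ω, hω⟩ := exists_walk_reads hN hge
  have hd := isDecomposition_dec hω.isWalk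
  generalize (dec ω).1 = p at hd
  generalize (dec ω).2 = cs at hd
  have hcardV : Fintype.card (List.Vector A N) = Fintype.card A ^ N := card_vector N
  rw [← hcardV]
  set V := Fintype.card (List.Vector A N)
  set D := cs.toFinset with hD
  set M := coeffBound V N with hM
  have hDlen : ∀ γ ∈ D, γ.length ≤ V + 1 := fun γ hγ =>
    (hd.isCycle γ (List.mem_toFinset.1 hγ)).length_le
  have hDcard : D.card ≤ (V + 1) ^ (V + 1) := card_le_of_length_le D _ hDlen
  have hplen : p.length ≤ V := hd.isPath.length_le
  have hocc : ∀ u, ∀ γ ∈ D, walkOcc u γ ≤ V := fun u γ hγ =>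
    (walkOcc_le u γ).trans (by have := hDlen γ hγ; omega)
  set base : List A → ℕ := fun u => pathOcc u p + ∑ γ ∈ D, walkOcc u γ with hbase
  -- The summands of `coeffBound`: `N + 1` for the first window, `V` for the path, `V * (V + 1) ^ (V
  -- + 1)` for one tour of each distinct cycle, and one more to absorb the `-1` in `c - 1`.
  have hbase_le : ∀ u, base u + 1 ≤ M := by
    intro u
    obtain ⟨v, hv⟩ : ∃ v, p.head? = some v :=
      ⟨p.head hd.isPath.1.1, (List.head?_eq_some_head _)⟩
    have h1 := occ_le u v.toList
    rw [v.toList_length] at h1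
    have h2 := walkOcc_le u p
    have h3 : ∑ γ ∈ D, walkOcc u γ ≤ V * (V + 1) ^ (V + 1) :=
      (Finset.sum_le_card_nsmul D _ V (hocc u)).trans (by
        rw [smul_eq_mul, mul_comm]; gcongr)
    simp only [hbase, pathOcc_eq hv, hM, coeffBound]
    omega
  have hVM : V ≤ M := by simp only [hM, coeffBound]; omega
  have hle : D.val ≤ (cs : Multiset _) := Multiset.dedup_le _
  -- The surplus: all cycles with multiplicity, minus one copy of each.
  set S : Multiset (List (List.Vector A N)) := (cs : Multiset _) - D.val with hS
  have hSD : ∀ γ ∈ S, γ ∈ D := fun γ hγ =>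
    List.mem_toFinset.2 (Multiset.mem_coe.1 (Multiset.mem_of_le tsub_le_self hγ))
  have hSocc : ∀ u : List A, u.length ≤ N → occ u w = base u + (S.map (walkOcc u)).sum := by
    intro u hu
    have : (cs.map (walkOcc u)).sum = (S.map (walkOcc u)).sum + ∑ γ ∈ D, walkOcc u γ := by
      rw [Finset.sum, ← Multiset.sum_add, ← Multiset.map_add, hS, tsub_add_cancel_of_le hle,
        Multiset.map_coe, Multiset.sum_coe]
    rw [hd.occ_eq hω hu, this]
    simp only [hbase]
    omega
  have hdiff : ∀ u v, ∀ γ ∈ S, |(walkOcc u γ : ℤ) - walkOcc v γ| ≤ M := by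
    intro u v γ hγ
    have h1 := hocc u γ (hSD γ hγ)
    have h2 := hocc v γ (hSD γ hγ)
    rw [abs_le]
    omega
  obtain ⟨T, hTS, hT1, hT2, hT3⟩ := exists_small_solution
    ((ws ×ˢ ws).map fun q =>
      (fun γ : List (List.Vector A N) => (walkOcc q.1 γ : ℤ) - walkOcc q.2 γ,
        (base q.1 : ℤ) - base q.2))
    (fun γ => (walkOcc x γ : ℤ) - walkOcc y γ) ((base x : ℤ) - base y) M
    (by simp only [hM, coeffBound]; omega) S
    (by
      intro f hf
      obtain ⟨q, -, rfl⟩ := List.mem_map.1 hf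
      exact hdiff q.1 q.2)
    (by
      intro f hf
      obtain ⟨q, -, rfl⟩ := List.mem_map.1 hf
      have h1 := hbase_le q.1
      have h2 := hbase_le q.2
      rw [abs_le]
      dsimp only
      omega)
    (hdiff x y)
    (by
      have h1 := hbase_le x
      have h2 := hbase_le y
      rw [abs_le]
      omega)
    (by
      intro f hf
      obtain ⟨⟨u, v⟩, hq, rfl⟩ := List.mem_map.1 hf
      obtain ⟨hq1, hq2⟩ := List.mem_product.1 hq
      have h1 := hSocc _ (hws _ hq1)
      have h2 := hSocc _ (hws _ hq2)
      have h3 := hw _ hq1 _ hq2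
      dsimp only
      rw [sum_map_sub]
      omega)
    (by
      have h1 := hSocc _ (hws' _ hx)
      have h2 := hSocc _ (hws' _ hy)
      rw [sum_map_sub]
      omega)
  have hTD : ∀ γ ∈ T, γ ∈ D := fun γ hγ => hSD γ (hTS γ hγ)
  -- The summand `1` is the copy counted in `base`; it keeps every multiplicity positive.
  obtain ⟨w', hlen, hw₁⟩ := hd.exists_word (fun γ => 1 + T.count γ) (fun _ _ => by omega)
  simp only [← hD, sum_one_add_count_mul D T hTD, ← add_assoc] at hlen hw₁
  refine ⟨w', ?_, ?_, ?_⟩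
  · have h1 : ∑ γ ∈ D, (γ.length - 1) ≤ V * (V + 1) ^ (V + 1) :=
      (Finset.sum_le_card_nsmul D _ V (fun γ hγ => by have := hDlen γ hγ; omega)).trans (by
        rw [smul_eq_mul, mul_comm]; gcongr)
    have h2 : (T.map fun γ => γ.length - 1).sum ≤
        V * (2 * M + 1) ^ 3 ^ (ws.length * ws.length + 1) := by
      refine (Multiset.sum_le_card_nsmul _ V ?_).trans ?_
      · intro n hn
        obtain ⟨γ, hγ, rfl⟩ := Multiset.mem_map.1 hn
        have := hDlen γ (hTD γ hγ)
        omega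
      · rw [Multiset.card_map, smul_eq_mul, mul_comm]
        gcongr
        simpa [List.length_product] using hT3
    rw [hlen, witnessBound, ← hM]
    have : M = N + 2 + V + V * (V + 1) ^ (V + 1) := rfl
    omega
  · intro u hu v hv
    have := hT1 _ (List.mem_map.2 ⟨(u, v), List.mem_product.2 ⟨hu, hv⟩, rfl⟩)
    dsimp only at this
    rw [sum_map_sub] at this
    rw [hw₁ u (hws u hu), hw₁ v (hws v hv)]
    simp only [hbase] at this
    omega
  · intro hcon
    have := hcon x hx y hy
    rw [hw₁ x (hws' x hx), hw₁ y (hws' y hy)] at this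
    rw [sum_map_sub] at hT2
    simp only [hbase] at hT2
    omega

/-- The bound of `exists_short_witness` in both directions. -/
def searchBound (K : ℕ) (ws ws' : List (List A)) : ℕ :=
  max (witnessBound (K ^ (maxLength (ws ++ ws') + 1)) (maxLength (ws ++ ws') + 1) ws.length)
    (witnessBound (K ^ (maxLength (ws ++ ws') + 1)) (maxLength (ws ++ ws') + 1) ws'.length)

/-- Any dimension at least the maximal length serves; the successor guarantees a nonzero one, so no
case `N = 0` arises. -/
theorem WMIX_eq_iff_forall_short (ws ws' : List (List A)) :
    WMIX ws = WMIX ws' ↔ ∀ w : List A, w.length ≤ searchBound (Fintype.card A) ws ws' →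
      (w ∈ WMIX ws ↔ w ∈ WMIX ws') := by
  have hws : ∀ u ∈ ws, u.length ≤ maxLength (ws ++ ws') + 1 := fun u hu =>
    (length_le_maxLength (List.mem_append_left _ hu)).trans (Nat.le_succ _)
  have hws' : ∀ u ∈ ws', u.length ≤ maxLength (ws ++ ws') + 1 := fun u hu =>
    (length_le_maxLength (List.mem_append_right _ hu)).trans (Nat.le_succ _)
  refine ⟨fun h w _ => by rw [h], fun h => ?_⟩
  ext w
  constructor
  · intro hw
    by_contra hw'
    obtain ⟨w₁, h1, h2, h3⟩ := exists_short_witness (Nat.succ_ne_zero _) hws hws' hw hw'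
    exact h3 ((h w₁ (h1.trans (le_max_left _ _))).1 h2)
  · intro hw
    by_contra hw'
    obtain ⟨w₁, h1, h2, h3⟩ := exists_short_witness (Nat.succ_ne_zero _) hws' hws hw hw'
    exact h3 ((h w₁ (h1.trans (le_max_right _ _))).2 h2)

end Witness

/-! ### Primitive recursiveness of the bounded search -/

section Computability

open Primrec

variable {A : Type*}

/-- Occurrences are counted by their end position `i`. If `u` is longer than the prefix, the
truncated subtraction drops nothing and the equality fails, as it should. -/
theorem occ_eq_length_filter [DecidableEq A] (u w : List A) :
    occ u w = ((List.range (w.length + 1)).filter fun i =>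
      (w.take i).drop ((w.take i).length - u.length) = u).length := by
  have h : ∀ i, ((w.take i).drop ((w.take i).length - u.length) = u) ↔ u <:+ w.take i :=
    fun i => by rw [List.suffix_iff_eq_drop, eq_comm]
  simp only [h]
  clear h
  induction w using List.reverseRecOn with
  | nil =>
    cases u with
    | nil =>
      rw [occ, Set.ncard_eq_one.2 ⟨([], []), by ext ⟨x, y⟩; simp⟩]
      simp
    | cons a u =>
      rw [occ, show {p : List A × List A | p.1 ++ a :: u ++ p.2 = []} = ∅ by ext ⟨x, y⟩; simp]
      simp
  | append_singleton w b ih =>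
    rw [occ_append_singleton, ih, List.length_append, List.length_singleton,
      List.range_succ (n := w.length + 1), List.filter_append, List.length_append]
    congr 1
    · congr 1
      refine List.filter_congr fun i hi => ?_
      rw [List.take_append_of_le_length (by simpa [Nat.lt_succ_iff] using hi)]
    · have htake : (w ++ [b]).take (w.length + 1) = w ++ [b] := List.take_of_length_le (by simp)
      by_cases h : u <:+ w ++ [b] <;> simp [htake, h]

/-- The words of length at most `n` over the letters of `l`. -/
def wordsUpTo (l : List A) : ℕ → List (List A) :=
  Nat.rec [[]] fun _ L => [] :: L.flatMap fun w => l.map fun a => a :: w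

theorem mem_wordsUpTo {l : List A} (hl : ∀ a, a ∈ l) {n : ℕ} {w : List A} :
    w ∈ wordsUpTo l n ↔ w.length ≤ n := by
  induction n generalizing w with
  | zero => simp [wordsUpTo]
  | succ n ih =>
    change w ∈ [] :: (wordsUpTo l n).flatMap (fun w => l.map fun a => a :: w) ↔ _
    cases w with
    | nil => simp
    | cons a w => simp [ih, hl]

variable [Primcodable A]

theorem primrec_occ [DecidableEq A] : Primrec₂ (occ : List A → List A → ℕ) := by
  have hrel : PrimrecRel fun (i : ℕ) (q : List A × List A) =>
      (q.2.take i).drop ((q.2.take i).length - q.1.length) = q.1 := by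
    have htake : Primrec fun r : ℕ × List A × List A => r.2.2.take r.1 :=
      list_take.comp fst (snd.comp snd)
    exact Primrec.eq.comp (list_drop.comp
      (nat_sub.comp (list_length.comp htake) (list_length.comp (fst.comp snd))) htake)
      (fst.comp snd)
  have h : Primrec fun q : List A × List A => ((List.range (q.2.length + 1)).filter fun i =>
      (q.2.take i).drop ((q.2.take i).length - q.1.length) = q.1).length :=
    list_length.comp (hrel.listFilter.comp
      (list_range.comp (succ.comp (list_length.comp snd))) .id)
  exact h.of_eq fun q => (occ_eq_length_filter q.1 q.2).symm

theorem primrec_mem_WMIX [DecidableEq A] :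
    PrimrecRel fun (w : List A) (ws : List (List A)) => w ∈ WMIX ws := by
  have h1 : PrimrecRel fun (v : List A) (q : List A × List A) => occ q.1 q.2 = occ v q.2 :=
    Primrec.eq.comp (primrec_occ.comp (fst.comp snd) (snd.comp snd))
      (primrec_occ.comp fst (snd.comp snd))
  have h2 : PrimrecRel fun (u : List A) (q : List A × List (List A)) =>
      ∀ v ∈ q.2, occ u q.1 = occ v q.1 :=
    h1.forall_mem_list.comp (snd.comp snd) (pair fst (fst.comp snd))
  exact (h2.forall_mem_list.comp snd .id :)

theorem primrec_wordsUpTo (l : List A) : Primrec (wordsUpTo l) := by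
  refine nat_rec₁ _ (list_cons.comp (const []) (list_flatMap snd ?_))
  exact list_map (const l) (list_cons.comp snd (snd.comp fst))

theorem primrec_maxLength : Primrec (maxLength : List (List A) → ℕ) :=
  list_foldr (list_map .id (list_length.comp snd).to₂) (const 0)
    (nat_max.comp (fst.comp snd) (snd.comp snd)).to₂

theorem primrec_pow : Primrec₂ ((· ^ ·) : ℕ → ℕ → ℕ) :=
  Primrec₂.unpaired'.1 Nat.Primrec.pow

theorem primrec_coeffBound : Primrec₂ coeffBound :=
  nat_add.comp (nat_add.comp (nat_add.comp snd (const 2)) fst)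
    (nat_mul.comp fst (primrec_pow.comp (succ.comp fst) (succ.comp fst)))

theorem primrec_witnessBound :
    Primrec fun q : ℕ × ℕ × ℕ => witnessBound q.1 q.2.1 q.2.2 := by
  have h : Primrec fun q : ℕ × ℕ × ℕ => coeffBound q.1 q.2.1 :=
    primrec_coeffBound.comp fst (fst.comp snd)
  have hk : Primrec fun q : ℕ × ℕ × ℕ => q.2.2 := snd.comp snd
  exact nat_add.comp h (nat_mul.comp fst (primrec_pow.comp
    (succ.comp (nat_mul.comp (const 2) h))
    (primrec_pow.comp (const 3) (succ.comp (nat_mul.comp hk hk)))))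

theorem primrec_searchBound (K : ℕ) :
    Primrec₂ (searchBound K : List (List A) → List (List A) → ℕ) := by
  have hN : Primrec fun p : List (List A) × List (List A) => maxLength (p.1 ++ p.2) + 1 :=
    succ.comp (primrec_maxLength.comp (list_append.comp fst snd))
  have hV := primrec_pow.comp (const K) hN
  exact nat_max.comp
    (primrec_witnessBound.comp (pair hV (pair hN (list_length.comp fst))))
    (primrec_witnessBound.comp (pair hV (pair hN (list_length.comp snd))))

/-- The length bound and the membership test are primitive recursive, and finiteness of `A` makes
the list of words to be tested finite. -/
theorem computablePred_WMIX_eq [DecidableEq A] [Finite A] :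
    ComputablePred fun p : List (List A) × List (List A) => WMIX p.1 = WMIX p.2 := by
  cases nonempty_fintype A
  have hrel : PrimrecRel fun (w : List A) (p : List (List A) × List (List A)) =>
      (w ∈ WMIX p.1 ∧ w ∈ WMIX p.2) ∨ (¬ w ∈ WMIX p.1 ∧ ¬ w ∈ WMIX p.2) := by
    have h1 : PrimrecPred fun q : List A × List (List A) × List (List A) => q.1 ∈ WMIX q.2.1 :=
      primrec_mem_WMIX.comp fst (fst.comp snd)
    have h2 : PrimrecPred fun q : List A × List (List A) × List (List A) => q.1 ∈ WMIX q.2.2 :=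
      primrec_mem_WMIX.comp fst (snd.comp snd)
    exact (h1.and h2).or (h1.not.and h2.not)
  have h := hrel.forall_mem_list.comp
    ((primrec_wordsUpTo (Finset.univ : Finset A).toList).comp
      (primrec_searchBound (A := A) (Fintype.card A))) .id
  refine (PrimrecPred.of_eq h fun p => ?_).computablePred
  rw [WMIX_eq_iff_forall_short]
  refine forall_congr' fun w => ?_
  rw [mem_wordsUpTo (by simp)]
  refine imp_congr_right fun _ => ?_
  dsimp only [id]
  tauto

end Computability

end WordMix

theorem corollary2 {A : Type*} [Finite A] [DecidableEq A] [Primcodable A] :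
    ComputablePred (fun p : List (List A) × List (List A) =>
      WordMix.WMIX p.1 = WordMix.WMIX p.2) ∧
    ∀ (ws ws' : List (List A)) (N : ℕ), N = WordMix.maxLength (ws ++ ws') →
      (WordMix.traces (WordMix.deBruijn A N)).Finite ∧
      (∀ (π : List (List.Vector A N)) (γs : List (List (List.Vector A N))),
        (WordMix.psi ws ws' π γs).IsUniversal) ∧
      (WordMix.WMIX ws = WordMix.WMIX ws' ↔
        (∀ w : List A, w.length < N → (w ∈ WordMix.WMIX ws ↔ w ∈ WordMix.WMIX ws')) ∧
        ∀ T ∈ WordMix.traces (WordMix.deBruijn A N),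
          ∀ (π : List (List.Vector A N)) (γs : List (List (List.Vector A N))),
            WordMix.Enumerates (WordMix.deBruijn A N) T π γs →
              FirstOrder.Language.Sentence.Realize ℕ (WordMix.psi ws ws' π γs)) :=
  ⟨WordMix.computablePred_WMIX_eq, fun ws ws' _ hN =>
    ⟨WordMix.finite_traces _, fun π γs => WordMix.isUniversal_psi ws ws' π γs,
      WordMix.WMIX_eq_iff ws ws' hN⟩⟩
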